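/- Let $\mathcal N$ and $\mathcal Q$ be finite sets. The Hamming graph $H(\mathcal N,\mathcal Q)$ has as vertices all functions $\mathcal N\to\mathcal Q$, two being adjacent if and only if they differ in exactly one entry. For a code (a set of vertices) $\mathcal C$, let $\mathcal C_i$ be the set of vertices at distance $i$ from some element of $\mathcal C$ and at distance $j$ from no element of $\mathcal C$ for all $j<i$; the covering radius of $\mathcal C$ is the largest $i$ with $\mathcal C_i\neq\emptyset$, and $\mathrm{Aut}(\mathcal C)$ is the setwise stabiliser of $\mathcal C$ in the automorphism group of $H(\mathcal N,\mathcal Q)$. The code $\mathcal C$ is $2$-neighbour-transitive if its covering radius is at least $2$ and $\mathrm{Aut}(\mathcal C)$ acts transitively on each of $\mathcal C$, $\mathcal C_1$ and $\mathcal C_2$. Let $q$ be a prime power, let $s\geq 1$, $t\geq 0$ and $\ell\geq 0$ be integers, and let $k$ be an integer with $0<k\leq q-1$. Let $N(a)=a^{(q^s-1)/(q-1)}$ be the norm from $\mathbb F_{q^s}$ to $\mathbb F_q$, and let $R(q,s,t,k)$ be the set of all polynomials $f\in\mathbb F_{q^s}[x_1,\ldots,x_t]$ such that $f(v)\in\mathbb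 F_q$ for all $v\in\mathbb F_{q^s}^t$ and $f(ax_1,\ldots,ax_t)=N(a)^kf(x_1,\ldots,x_t)$ for every $a\in\mathbb F_{q^s}$. Regarding polynomials as functions, define the following codes. - $\mathcal{RM}_q(\ell,t)$, in $H(\mathbb F_q^t,\mathbb F_q)$, consists of the functions given by all polynomials in $\mathbb F_q[x_1,\ldots,x_t]$ of degree at most $\ell$. - $\mathcal{RM}_{q^s/q}(\ell,t)$, in $H(\mathbb F_{q^s}^t,\mathbb F_q)$, consists of the elements of $\mathcal{RM}_{q^s}(\ell,t)$ all of whose values lie in $\mathbb F_q$. - $\mathcal{PRM}_{q^s/q}(\ell,t)$, in $H(\mathcal N,\mathbb F_q)$, where $\mathcal N$ is any set of representatives for the $1$-dimensional subspaces of $\mathbb F_{q^s}^t$, consists of the functions on $\mathcal N$ given by the polynomials in $R(q,s,t,k)$ of degree at most $\ell$. - $\mathcal{PRM}_q(\ell,t)$ is the case $s=1$ of the previous code. Then each of the following codes is $2$-neighbour-transitive: 1. $\mathcal{RM}_2(\ell,t)$ with $\ell\leq t-2$; 2. $\mathcal{RM}_{2^s/2}(\ell,t)$ with $\ell\leq (t-1)(2^s-1)-1$;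 3. $\mathcal{PRM}_q(\ell,t)$ with $\ell\leq (t-1)(q-1)-2$ and $\gcd(k,q-1)=1$; 4. $\mathcal{PRM}_{q^s/q}(\ell,t)$ with $\ell\leq (t-1)(q^s-1)-2$ and $\gcd(k,q-1)=1$. -/

import Mathlib

namespace NTCodes

/-- The Hamming graph `H(N, Q)`: the vertices are the functions `N → Q`, and two of them are
adjacent when they differ in precisely one entry. -/
def hammingGraph (N Q : Type*) : SimpleGraph (N → Q) where
  Adj α β := ∃! i, α i ≠ β i
  symm := ⟨fun _ _ ⟨i, hi, hu⟩ => ⟨i, hi.symm, fun j hj => hu j hj.symm⟩⟩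
  loopless := ⟨fun _ ⟨_, hi, _⟩ => hi rfl⟩

section Codes

variable {N Q : Type*}

/-- `Aut(C)`: the setwise stabiliser of the code `C` in the full automorphism group of the
Hamming graph. -/
def codeAut (C : Set (N → Q)) : Subgroup (hammingGraph N Q ≃g hammingGraph N Q) where
  carrier := {g | ∀ α, g α ∈ C ↔ α ∈ C}
  one_mem' := fun _ => Iff.rfl
  mul_mem' := fun {g h} hg hh α => (hg (h α)).trans (hh α)
  inv_mem' := fun {g} hg α => by
    have h := hg (g⁻¹ α)
    rw [← RelIso.mul_apply, mul_inv_cancel] at h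
    exact h.symm

/-- `C_i`: the vertices at distance `i` from some codeword, and at distance `j` from no codeword
for each `j < i`. -/
def distSet (C : Set (N → Q)) (i : ℕ) : Set (N → Q) :=
  {α | (∃ β ∈ C, (hammingGraph N Q).dist α β = i) ∧
    ∀ j < i, ∀ β ∈ C, (hammingGraph N Q).dist α β ≠ j}

/-- The covering radius of `C` is the largest `i` for which `C_i` is non-empty. -/
def IsCoveringRadius (C : Set (N → Q)) (ρ : ℕ) : Prop :=
  IsGreatest {i | (distSet C i).Nonempty} ρ

/-- The group `G` acts transitively on the set `S` of vertices. -/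
def ActsTransitivelyOn (G : Subgroup (hammingGraph N Q ≃g hammingGraph N Q))
    (S : Set (N → Q)) : Prop :=
  (∀ g ∈ G, ∀ α ∈ S, g α ∈ S) ∧ ∀ α ∈ S, ∀ β ∈ S, ∃ g ∈ G, g α = β

/-- `C` is `(G, r)`-neighbour-transitive: `G ≤ Aut(C)`, `1 ≤ r ≤ ρ` where `ρ` is the covering
radius, and `G` is transitive on each of `C, C_1, …, C_r`. -/
def IsGNeighbourTransitive (G : Subgroup (hammingGraph N Q ≃g hammingGraph N Q))
    (r : ℕ) (C : Set (N → Q)) : Prop :=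
  G ≤ codeAut C ∧ 1 ≤ r ∧ (∃ ρ, IsCoveringRadius C ρ ∧ r ≤ ρ) ∧
    ActsTransitivelyOn G C ∧ ∀ i, 1 ≤ i → i ≤ r → ActsTransitivelyOn G (distSet C i)

/-- `C` is `r`-neighbour-transitive. -/
def IsNeighbourTransitive (r : ℕ) (C : Set (N → Q)) : Prop :=
  IsGNeighbourTransitive (codeAut C) r C

end Codes

section ReedMuller

open MvPolynomial

/-- `R(q, s, t, k)`, where `F`, `E` are the fields of orders `q`, `q ^ s`: the polynomials
`f ∈ E[x_1, …, x_t]` all of whose values lie in `F` and which satisfy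
`f(a x_1, …, a x_t) = N(a)^k f(x_1, …, x_t)` for each `a ∈ E`, where `N` is the norm of `E`
over `F`. -/
noncomputable def polyR (F E : Type*) [Field F] [Field E] [Algebra F E] (t k : ℕ) :
    Submodule F (MvPolynomial (Fin t) E) where
  carrier := {f | (∀ v : Fin t → E, eval v f ∈ Set.range (algebraMap F E)) ∧
    ∀ a : E, aeval (fun i => C a * X i) f = C (algebraMap F E (Algebra.norm F a) ^ k) * f}
  zero_mem' := ⟨fun _ => ⟨0, by simp⟩, fun _ => by simp⟩
  add_mem' := fun {f g} hf hg =>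
    ⟨fun v => by
      obtain ⟨x, hx⟩ := hf.1 v
      obtain ⟨y, hy⟩ := hg.1 v
      exact ⟨x + y, by simp [hx, hy]⟩,
     fun a => by rw [map_add, hf.2 a, hg.2 a, mul_add]⟩
  smul_mem' := fun b f hf =>
    ⟨fun v => by
      obtain ⟨x, hx⟩ := hf.1 v
      refine ⟨b * x, ?_⟩
      rw [← algebraMap_smul E b f, smul_eval, map_mul, hx],
     fun a => by
      rw [← algebraMap_smul E b f, map_smul, hf.2 a, mul_smul_comm]⟩

/-- The generalised Reed–Muller code `RM_q(ℓ, t)` in `H(F^t, F)`, where `F` has order `q`: the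
functions given by the polynomials in `F[x_1, …, x_t]` of degree at most `ℓ`. -/
noncomputable def RM (F : Type*) [Field F] (ℓ t : ℕ) : Submodule F ((Fin t → F) → F) where
  carrier := {c | ∃ f : MvPolynomial (Fin t) F, f.totalDegree ≤ ℓ ∧ ∀ v, c v = eval v f}
  zero_mem' := ⟨0, by simp, by simp⟩
  add_mem' := fun {c d} ⟨f, hf, hc⟩ ⟨g, hg, hd⟩ =>
    ⟨f + g, (totalDegree_add f g).trans (max_le hf hg), fun v => by simp [hc v, hd v]⟩
  smul_mem' := fun b c ⟨f, hf, hc⟩ =>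
    ⟨b • f, (totalDegree_smul_le b f).trans hf, fun v => by simp [hc v]⟩

/-- The subfield subcode `RM_{q^s/q}(ℓ, t)` in `H(E^t, F)`, where `F`, `E` have orders `q`,
`q ^ s`: the codewords of `RM_{q^s}(ℓ, t)` all of whose entries lie in `F`. -/
noncomputable def subfieldRM (F E : Type*) [Field F] [Field E] [Algebra F E] (ℓ t : ℕ) :
    Submodule F ((Fin t → E) → F) where
  carrier := {c | (fun v => algebraMap F E (c v)) ∈ RM E ℓ t}
  zero_mem' := by
    have h := (RM E ℓ t).zero_mem
    simpa [Pi.zero_def] using h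
  add_mem' := fun {c d} hc hd => by
    have h := (RM E ℓ t).add_mem hc hd
    simpa [Pi.add_def] using h
  smul_mem' := fun b c hc => by
    have h := (RM E ℓ t).smul_mem (algebraMap F E b) hc
    have e : (fun v => algebraMap F E ((b • c) v)) =
        algebraMap F E b • fun v => algebraMap F E (c v) := by
      funext v
      simp only [Pi.smul_apply, smul_eq_mul, map_mul]
    rw [Set.mem_ofPred_eq, e]
    exact h

/-- `S` is a set of representatives for the set of all `1`-dimensional subspaces of `E^t`. -/
def IsProjectiveReps {E : Type*} [Field E] {t : ℕ} (S : Set (Fin t → E)) : Prop :=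
  Set.BijOn (fun v => Submodule.span E {v}) S
    {W : Submodule E (Fin t → E) | Module.finrank E W = 1}

/-- The code `PRM_{q^s/q}(ℓ, t)` in `H(S, F)`, where `F`, `E` have orders `q`, `q ^ s`: the
functions on `S ⊆ E^t` given by the polynomials in `R(q, s, t, k)` of degree at most `ℓ`. -/
noncomputable def subfieldPRM (F E : Type*) [Field F] [Field E] [Algebra F E] (k ℓ t : ℕ)
    (S : Set (Fin t → E)) : Submodule F (S → F) where
  carrier := {c | ∃ f ∈ polyR F E t k, f.totalDegree ≤ ℓ ∧
    ∀ v : S, algebraMap F E (c v) = eval (v : Fin t → E) f}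
  zero_mem' := ⟨0, Submodule.zero_mem _, by simp, by simp⟩
  add_mem' := fun {c d} ⟨f, hfR, hf, hc⟩ ⟨g, hgR, hg, hd⟩ =>
    ⟨f + g, Submodule.add_mem _ hfR hgR, (totalDegree_add f g).trans (max_le hf hg),
      fun v => by simp [hc v, hd v]⟩
  smul_mem' := fun b c ⟨f, hfR, hf, hc⟩ =>
    ⟨b • f, Submodule.smul_mem _ b hfR, (totalDegree_smul_le b f).trans hf, fun v => by
      rw [← algebraMap_smul E b f, smul_eval, ← hc v]
      simp⟩

/-- The projective Reed–Muller code `PRM_q(ℓ, t)` in `H(S, F)`, where `F` has order `q`: the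
case `s = 1`, so the functions given by the polynomials in `R(q, 1, t, k)` of degree at
most `ℓ`. -/
noncomputable def PRM (F : Type*) [Field F] (k ℓ t : ℕ) (S : Set (Fin t → F)) :
    Submodule F (S → F) :=
  subfieldPRM F F k ℓ t S

end ReedMuller

end NTCodes

namespace NTCodes

/-! ### Graph distance in the Hamming graph is Hamming distance. -/

section Distance

variable {N Q : Type*}

/-! All four codes are linear, so translations by codewords lie in `Aut(C)`, and a vertex of `C_i`
is a codeword plus a vector of weight `i`. It therefore suffices that `Aut(C)` moves any vector of
weight 1 or 2 to any other of the same weight (`MonomiallyTwoTransitive`), and that the minimum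
weight is at least 4, which makes `C_2` non-empty
(`isNeighbourTransitive_two_of_monomiallyTwoTransitive`).

The symmetries come from affine maps (scalars are trivial over a field of order 2) and,
projectively, from `GL_t(E)`, whose rescaling of representatives yields every scalar `N(b)^k`
because the norm is surjective and `k` is coprime to `q - 1`.

The weight bound rests on one fact: over a field of order `Q`, the values of a polynomial of degree
less than `(Q - 1) t` sum to zero. If a codeword had small weight, a low-degree multiplier would
kill all of its support but one point, and the sum would be non-zero (`eval_mul_eval_eq_zero`). -/

theorem hammingGraph_adj_iff_hammingDist [Fintype N] [DecidableEq Q] {α β : N → Q} :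
    (hammingGraph N Q).Adj α β ↔ hammingDist α β = 1 := by
  rw [hammingDist, Finset.card_eq_one]
  constructor
  · rintro ⟨i, hi, hu⟩
    refine ⟨i, Finset.ext fun j => ?_⟩
    simp only [Finset.mem_filter, Finset.mem_univ, true_and, Finset.mem_singleton]
    exact ⟨hu j, fun h => h ▸ hi⟩
  · rintro ⟨i, hi⟩
    have h : ∀ j, α j ≠ β j ↔ j = i := fun j => by
      simpa using Finset.ext_iff.1 hi j
    exact ⟨i, (h i).2 rfl, fun j hj => (h j).1 hj⟩

theorem hammingDist_le_length [Fintype N] [DecidableEq Q] {α β : N → Q}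
    (w : (hammingGraph N Q).Walk α β) : hammingDist α β ≤ w.length := by
  induction w with
  | nil => simp
  | @cons a b c h p ih =>
    have h1 := hammingGraph_adj_iff_hammingDist.1 h
    have h2 := hammingDist_triangle a b c
    rw [SimpleGraph.Walk.length_cons]
    omega

theorem exists_walk_length_eq_hammingDist [Fintype N] [DecidableEq Q] (α β : N → Q) :
    ∃ w : (hammingGraph N Q).Walk α β, w.length = hammingDist α β := by
  classical
  induction hn : hammingDist α β generalizing α with
  | zero =>
    obtain rfl := hammingDist_eq_zero.1 hn
    exact ⟨.nil, rfl⟩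
  | succ n ih =>
    have hne : α ≠ β := fun h => by simp [h] at hn
    obtain ⟨i, hi⟩ := Function.ne_iff.1 hne
    have hadj : (hammingGraph N Q).Adj α (Function.update α i (β i)) := by
      refine ⟨i, by simpa using hi, fun j hj => ?_⟩
      by_contra hji
      exact hj (by simp [hji])
    have hd : hammingDist (Function.update α i (β i)) β = n := by
      have he : (Finset.univ.filter fun j => Function.update α i (β i) j ≠ β j) =
          (Finset.univ.filter fun j => α j ≠ β j).erase i := by
        ext j
        by_cases hji : j = i
        · subst hji; simp
        · simp [hji]
      rw [hammingDist, he, Finset.card_erase_of_mem (by simpa using hi)]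
      rw [hammingDist] at hn
      omega
    obtain ⟨w, hw⟩ := ih _ hd
    exact ⟨.cons hadj w, by simp [hw]⟩

theorem dist_hammingGraph [Fintype N] [DecidableEq Q] (α β : N → Q) :
    (hammingGraph N Q).dist α β = hammingDist α β := by
  obtain ⟨w, hw⟩ := exists_walk_length_eq_hammingDist α β
  obtain ⟨w', hw'⟩ := w.reachable.exists_walk_length_eq_dist
  exact le_antisymm (hw ▸ SimpleGraph.dist_le w) (hw' ▸ hammingDist_le_length w')

theorem dist_map_le [Finite N] (g : hammingGraph N Q ≃g hammingGraph N Q) (α β : N → Q) :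
    (hammingGraph N Q).dist (g α) (g β) ≤ (hammingGraph N Q).dist α β := by
  classical
  have := Fintype.ofFinite N
  obtain ⟨w, -⟩ := exists_walk_length_eq_hammingDist α β
  obtain ⟨w', hw'⟩ := w.reachable.exists_walk_length_eq_dist
  rw [← hw', ← SimpleGraph.Walk.length_map g.toHom w']
  exact SimpleGraph.dist_le _

theorem dist_map [Finite N] (g : hammingGraph N Q ≃g hammingGraph N Q) (α β : N → Q) :
    (hammingGraph N Q).dist (g α) (g β) = (hammingGraph N Q).dist α β := by
  refine le_antisymm (dist_map_le g α β) ?_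
  simpa using dist_map_le g.symm (g α) (g β)

theorem map_mem_distSet [Finite N] {C : Set (N → Q)}
    {g : hammingGraph N Q ≃g hammingGraph N Q} (hg : g ∈ codeAut C) {i : ℕ} {α : N → Q}
    (hα : α ∈ distSet C i) : g α ∈ distSet C i := by
  obtain ⟨⟨β, hβ, hd⟩, hmin⟩ := hα
  refine ⟨⟨g β, (hg β).2 hβ, by rw [dist_map, hd]⟩, fun j hj γ hγ => ?_⟩
  have hγ' : g.symm γ ∈ C := by
    rw [← hg]; simpa using hγ
  have := hmin j hj _ hγ'
  rwa [← dist_map g, RelIso.apply_symm_apply] at this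

/-- An injective self-map of a finite set is onto, so one inclusion is enough. -/
theorem mem_codeAut_of_forall_mem [Finite N] [Finite Q] {C : Set (N → Q)}
    {g : hammingGraph N Q ≃g hammingGraph N Q} (hg : ∀ α ∈ C, g α ∈ C) : g ∈ codeAut C := by
  intro α
  refine ⟨fun h => ?_, hg α⟩
  have hs : g '' C = C :=
    Set.eq_of_subset_of_ncard_le (Set.image_subset_iff.2 hg)
      (Set.ncard_image_of_injective C g.injective).ge (Set.toFinite C)
  rw [← hs] at h
  exact (g.injective.mem_set_image).1 h

end Distance

/-! ### Linear codes with many monomial symmetries. -/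

section Linear

variable {N F : Type*} [Field F]

/-- Translation by `c`, as an automorphism of the Hamming graph. -/
def translation (c : N → F) : hammingGraph N F ≃g hammingGraph N F where
  toEquiv := Equiv.addLeft c
  map_rel_iff' := by
    intro a b
    simp [hammingGraph]

/-- The monomial map `α ↦ (n ↦ u n * α (σ n))`, as an automorphism of the Hamming graph. -/
def monomialMap (σ : Equiv.Perm N) (u : N → Fˣ) : hammingGraph N F ≃g hammingGraph N F where
  toFun α n := u n * α (σ n)
  invFun α m := ↑(u (σ.symm m))⁻¹ * α (σ.symm m)
  left_inv α := by ext; simp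
  right_inv α := by ext; simp
  map_rel_iff' := by
    intro a b
    simp only [hammingGraph, Equiv.coe_fn_mk, ne_eq, Units.mul_right_inj]
    exact σ.existsUnique_congr fun _ => Iff.rfl

@[simp]
theorem translation_apply (c α : N → F) : translation c α = c + α := rfl

@[simp]
theorem monomialMap_apply (σ : Equiv.Perm N) (u : N → Fˣ) (α : N → F) (n : N) :
    monomialMap σ u α n = u n * α (σ n) := rfl

theorem translation_mem_codeAut (C : Submodule F (N → F)) {c : N → F} (hc : c ∈ C) :
    translation c ∈ codeAut (C : Set (N → F)) := fun _ => C.add_mem_iff_right hc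

/-- The code `C` is preserved by monomial maps that send any ordered pair of distinct coordinates
to any other, with arbitrary prescribed scalars in those two coordinates. -/
def MonomiallyTwoTransitive (C : Set (N → F)) : Prop :=
  ∀ i j i' j' : N, i ≠ j → i' ≠ j' → ∀ a b : Fˣ, ∃ (σ : Equiv.Perm N) (u : N → Fˣ),
    (∀ α ∈ C, monomialMap σ u α ∈ C) ∧ σ i' = i ∧ σ j' = j ∧ u i' = a ∧ u j' = b

theorem exists_support_of_hammingNorm_eq_one [Fintype N] [DecidableEq F] {w : N → F}
    (hw : hammingNorm w = 1) : ∃ i, w i ≠ 0 ∧ ∀ n, n ≠ i → w n = 0 := by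
  rw [hammingNorm, Finset.card_eq_one] at hw
  obtain ⟨i, hi⟩ := hw
  have h : ∀ n, w n ≠ 0 ↔ n = i := fun n => by simpa using Finset.ext_iff.1 hi n
  exact ⟨i, (h i).2 rfl, fun n hn => by_contra fun h' => hn ((h n).1 h')⟩

theorem exists_support_of_hammingNorm_eq_two [Fintype N] [DecidableEq F] {w : N → F}
    (hw : hammingNorm w = 2) :
    ∃ i j, i ≠ j ∧ w i ≠ 0 ∧ w j ≠ 0 ∧ ∀ n, n ≠ i → n ≠ j → w n = 0 := by
  classical
  rw [hammingNorm, Finset.card_eq_two] at hw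
  obtain ⟨i, j, hij, hi⟩ := hw
  have h : ∀ n, w n ≠ 0 ↔ n = i ∨ n = j := fun n => by simpa using Finset.ext_iff.1 hi n
  exact ⟨i, j, hij, (h i).2 (.inl rfl), (h j).2 (.inr rfl),
    fun n hn hn' => by_contra fun h' => ((h n).1 h').elim hn hn'⟩

theorem MonomiallyTwoTransitive.exists_map_eq_of_eq_one [Fintype N] [Nontrivial N] [Finite F]
    [DecidableEq F] {C : Set (N → F)} (hC : MonomiallyTwoTransitive C) {w w' : N → F}
    (hw : hammingNorm w = 1) (hw' : hammingNorm w' = 1) : ∃ g ∈ codeAut C, g w = w' := by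
  obtain ⟨i, hi, hw⟩ := exists_support_of_hammingNorm_eq_one hw
  obtain ⟨i', hi', hw'⟩ := exists_support_of_hammingNorm_eq_one hw'
  -- The second coordinates are dummies, there only to apply the two-point hypothesis.
  obtain ⟨j, hj⟩ := exists_ne i
  obtain ⟨j', hj'⟩ := exists_ne i'
  obtain ⟨σ, u, hσ, hσi, -, hui, -⟩ := hC i j i' j' hj.symm hj'.symm
    (Units.mk0 _ hi' * (Units.mk0 _ hi)⁻¹) 1
  refine ⟨monomialMap σ u, mem_codeAut_of_forall_mem hσ, funext fun n => ?_⟩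
  rw [monomialMap_apply]
  by_cases hn : n = i'
  · subst hn; simp [hui, hσi, hi]
  · rw [hw' n hn, hw (σ n) (by rw [← hσi]; simpa using hn), mul_zero]

theorem MonomiallyTwoTransitive.exists_map_eq_of_eq_two [Fintype N] [Finite F]
    [DecidableEq F] {C : Set (N → F)} (hC : MonomiallyTwoTransitive C) {w w' : N → F}
    (hw : hammingNorm w = 2) (hw' : hammingNorm w' = 2) : ∃ g ∈ codeAut C, g w = w' := by
  obtain ⟨i, j, hij, hi, hj, hw⟩ := exists_support_of_hammingNorm_eq_two hw
  obtain ⟨i', j', hij', hi', hj', hw'⟩ := exists_support_of_hammingNorm_eq_two hw'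
  obtain ⟨σ, u, hσ, hσi, hσj, hui, huj⟩ := hC i j i' j' hij hij'
    (Units.mk0 _ hi' * (Units.mk0 _ hi)⁻¹) (Units.mk0 _ hj' * (Units.mk0 _ hj)⁻¹)
  refine ⟨monomialMap σ u, mem_codeAut_of_forall_mem hσ, funext fun n => ?_⟩
  rw [monomialMap_apply]
  by_cases hn : n = i'
  · subst hn; simp [hui, hσi, hi]
  by_cases hn' : n = j'
  · subst hn'; simp [huj, hσj, hj]
  rw [hw' n hn hn', hw (σ n) (by rw [← hσi]; simpa using hn) (by rw [← hσj]; simpa using hn'),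
    mul_zero]

/-- Translate a nearest codeword to zero, match the error vectors, and translate to the other
codeword. -/
theorem actsTransitivelyOn_distSet [Fintype N] [DecidableEq F] (C : Submodule F (N → F)) {i : ℕ}
    (h : ∀ w w' : N → F, hammingNorm w = i → hammingNorm w' = i →
      ∃ g ∈ codeAut (C : Set (N → F)), g w = w') :
    ActsTransitivelyOn (codeAut (C : Set (N → F))) (distSet (C : Set (N → F)) i) := by
  refine ⟨fun g hg α hα => map_mem_distSet hg hα, ?_⟩
  rintro α ⟨⟨β, hβ, hd⟩, -⟩ α' ⟨⟨β', hβ', hd'⟩, -⟩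
  rw [dist_hammingGraph, hammingDist_comm, hammingDist_eq_hammingNorm] at hd hd'
  obtain ⟨g, hg, hgw⟩ := h _ _ hd hd'
  refine ⟨translation β' * g * translation (-β), mul_mem (mul_mem (translation_mem_codeAut C hβ') hg)
    (translation_mem_codeAut C (C.neg_mem hβ)), ?_⟩
  simp [RelIso.mul_apply, hgw]

theorem isNeighbourTransitive_two_of_monomiallyTwoTransitive [Fintype N] [Nontrivial N] [Finite F]
    [DecidableEq F] (C : Submodule F (N → F)) (hC : MonomiallyTwoTransitive (C : Set (N → F)))
    (hmin : ∀ c ∈ C, c ≠ 0 → 4 ≤ hammingNorm c) :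
    IsNeighbourTransitive 2 (C : Set (N → F)) := by
  classical
  have hne : (distSet (C : Set (N → F)) 2).Nonempty := by
    obtain ⟨i, j, hij⟩ := exists_pair_ne N
    let w : N → F := fun n => if n = i ∨ n = j then 1 else 0
    have hw : hammingNorm w = 2 := by
      rw [hammingNorm, ← Finset.card_pair hij]
      congr 1
      ext n
      simp [w, or_iff_not_imp_left]
    refine ⟨w, ⟨0, C.zero_mem, by rw [dist_hammingGraph, hammingDist_zero_right, hw]⟩, ?_⟩
    intro m hm β hβ hd
    rw [dist_hammingGraph] at hd
    by_cases h0 : β = 0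
    · rw [h0, hammingDist_zero_right] at hd
      omega
    -- A non-zero codeword has weight at least 4, so its distance from `w` is at least 4 - 2 = 2.
    · have h1 := hmin β hβ h0
      have h2 := hammingDist_triangle_left β 0 w
      rw [hammingDist_zero_right, hammingDist_zero_right] at h2
      omega
  have hbdd : BddAbove {i | (distSet (C : Set (N → F)) i).Nonempty} := by
    refine ⟨Fintype.card N, ?_⟩
    rintro i ⟨α, ⟨β, -, hd⟩, -⟩
    rw [← hd, dist_hammingGraph]
    exact hammingDist_le_card_fintype
  refine ⟨le_rfl, by norm_num, ⟨_, ⟨Nat.sSup_mem ⟨2, hne⟩ hbdd, fun i hi => le_csSup hbdd hi⟩,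
    le_csSup hbdd hne⟩, ⟨fun g hg α hα => (hg α).2 hα, fun α hα β hβ => ?_⟩, fun i h1 h2 => ?_⟩
  · exact ⟨translation (β - α), translation_mem_codeAut C (C.sub_mem hβ hα), by simp⟩
  · obtain rfl | rfl : i = 1 ∨ i = 2 := by omega
    · exact actsTransitivelyOn_distSet C fun _ _ => hC.exists_map_eq_of_eq_one
    · exact actsTransitivelyOn_distSet C fun _ _ => hC.exists_map_eq_of_eq_two

end Linear

end NTCodes

namespace NTCodes

open MvPolynomial

/-- An isomorphism between finite-dimensional subspaces extends to the whole space. -/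
theorem exists_linearEquiv_apply_eq {ι K V : Type*} [Finite ι] [Field K] [AddCommGroup V]
    [Module K V] {v w : ι → V} (hv : LinearIndependent K v) (hw : LinearIndependent K w) :
    ∃ g : V ≃ₗ[K] V, ∀ i, g (v i) = w i := by
  have : FiniteDimensional K (Submodule.span K (Set.range v)) :=
    FiniteDimensional.span_of_finite K (Set.finite_range v)
  obtain ⟨g, hg⟩ := Submodule.exists_linearEquiv_restrict_eq
    (hv.linearCombinationEquiv.symm ≪≫ₗ hw.linearCombinationEquiv)
  refine ⟨g, fun i => ?_⟩
  have h := hg (hv.linearCombinationEquiv (Finsupp.single i 1))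
  simpa using h.symm

/-! ### Linear forms as polynomials, and the vanishing sum. -/

section Polynomials

variable {E : Type*} [Field E] {t : ℕ}

/-- The linear polynomial that represents a linear form. -/
noncomputable def linearPoly (φ : (Fin t → E) →ₗ[E] E) : MvPolynomial (Fin t) E :=
  ∑ i, C (φ (Pi.single i 1)) * X i

@[simp]
theorem eval_linearPoly (φ : (Fin t → E) →ₗ[E] E) (v : Fin t → E) :
    eval v (linearPoly φ) = φ v := by
  conv_rhs => rw [← Finset.univ_sum_single v, map_sum]
  simp only [linearPoly, map_sum, map_mul, eval_C, eval_X]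
  refine Finset.sum_congr rfl fun i _ => ?_
  rw [mul_comm, ← smul_eq_mul, ← map_smul, ← Pi.single_smul, smul_eq_mul, mul_one]

theorem totalDegree_linearPoly_le (φ : (Fin t → E) →ₗ[E] E) :
    (linearPoly φ).totalDegree ≤ 1 :=
  totalDegree_finsetSum_le fun i _ => (totalDegree_mul _ _).trans (by simp)

theorem totalDegree_aeval_le {σ τ R : Type*} [CommSemiring R] {g : σ → MvPolynomial τ R}
    (hg : ∀ i, (g i).totalDegree ≤ 1) (f : MvPolynomial σ R) :
    (aeval g f).totalDegree ≤ f.totalDegree := by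
  rw [aeval_def, eval₂_eq]
  refine totalDegree_finsetSum_le fun d hd => ?_
  rw [algebraMap_eq]
  refine (totalDegree_mul _ _).trans ?_
  rw [totalDegree_C, zero_add]
  refine (totalDegree_finsetProd _ _).trans (le_trans ?_ (le_totalDegree hd))
  refine Finset.sum_le_sum fun i _ => (totalDegree_pow _ _).trans ?_
  simpa using Nat.mul_le_mul_left (d i) (hg i)

theorem eval_aeval {σ τ R : Type*} [CommSemiring R] (g : σ → MvPolynomial τ R) (v : τ → R)
    (f : MvPolynomial σ R) : eval v (aeval g f) = eval (fun i => eval v (g i)) f := by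
  induction f using MvPolynomial.induction_on with
  | C a => simp
  | add p q hp hq => rw [map_add, map_add, map_add, hp, hq]
  | mul_X p i hp => rw [map_mul, map_mul, map_mul, hp, aeval_X, eval_X]

/-- The sum of all values of `f * g` is zero by the degree bound, and only the term at `p` can
survive. -/
theorem eval_mul_eval_eq_zero [Fintype E] {f g : MvPolynomial (Fin t) E}
    (hdeg : f.totalDegree + g.totalDegree < (Fintype.card E - 1) * t) {p : Fin t → E}
    (h : ∀ x, x ≠ p → eval x f * eval x g = 0) : eval p f * eval p g = 0 := by
  have hs := sum_eval_eq_zero (f * g)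
    (by rw [Fintype.card_fin]; exact (totalDegree_mul f g).trans_lt hdeg)
  simp only [map_mul] at hs
  rwa [Finset.sum_eq_single p (fun x _ hx => h x hx) (by simp)] at hs

end Polynomials

/-! ### Affine codes over the field of order 2. -/

section Affine

variable {F E : Type*} [Field F] [Field E] [Algebra F E]

/-- Every non-zero entry is 1, so the vanishing sum of values makes the weight even. Weight 2 is
excluded by a degree-one multiplier that vanishes at one support point and not at the other. -/
theorem four_le_hammingNorm_of_mem_subfieldRM [Fintype E] [DecidableEq F] {t ℓ : ℕ}
    (hF : Nat.card F = 2) (hℓ : ℓ + (Fintype.card E - 1) < (Fintype.card E - 1) * t)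
    {c : (Fin t → E) → F} (hc : c ∈ subfieldRM F E ℓ t) (h0 : c ≠ 0) : 4 ≤ hammingNorm c := by
  have : Finite F := Nat.finite_of_card_ne_zero (by omega)
  have := Fintype.ofFinite F
  rw [Nat.card_eq_fintype_card] at hF
  have : Fact (Nat.Prime 2) := ⟨Nat.prime_two⟩
  have : CharP F 2 := charP_of_card_eq_prime hF
  have hone : ∀ a : F, a ≠ 0 → a = 1 := fun a ha => by
    simpa [hF] using FiniteField.pow_card_sub_one_eq_one a ha
  obtain ⟨f, hf, hcf⟩ := hc
  have hQ : 1 < Fintype.card E := Fintype.one_lt_card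
  have heven : 2 ∣ hammingNorm c := by
    rw [← CharP.cast_eq_zero_iff F 2]
    apply (algebraMap F E).injective
    have hsum : ∑ x, c x = (hammingNorm c : F) := by
      rw [hammingNorm, Finset.card_filter, Nat.cast_sum]
      refine Finset.sum_congr rfl fun x _ => ?_
      by_cases hx : c x = 0
      · simp [hx]
      · simp [hone _ hx]
    rw [← hsum, map_sum, map_zero, ← sum_eval_eq_zero f (by rw [Fintype.card_fin]; omega)]
    exact Finset.sum_congr rfl fun x _ => hcf x
  by_contra hlt
  have hpos := hammingNorm_pos_iff.2 h0
  have htwo : hammingNorm c = 2 := by omega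
  obtain ⟨p, r, hpr, hp, hr, hsupp⟩ := exists_support_of_hammingNorm_eq_two htwo
  obtain ⟨i, hi⟩ := Function.ne_iff.1 hpr
  have hdeg : (X i - C (r i) : MvPolynomial (Fin t) E).totalDegree ≤ 1 :=
    (totalDegree_sub_C_le _ _).trans (by simp)
  have h := eval_mul_eval_eq_zero (f := f) (g := X i - C (r i)) (p := p) (by omega) fun x hx => by
    by_cases hxr : x = r
    · simp [hxr]
    · simp [← hcf, hsupp x hx hxr]
  rw [← hcf] at h
  simp [hp, sub_eq_zero, hi] at h

theorem monomiallyTwoTransitive_subfieldRM (hF : Nat.card F = 2) (ℓ t : ℕ) :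
    MonomiallyTwoTransitive (subfieldRM F E ℓ t : Set ((Fin t → E) → F)) := by
  have : Finite F := Nat.finite_of_card_ne_zero (by omega)
  have := Fintype.ofFinite F
  rw [Nat.card_eq_fintype_card] at hF
  have hone : ∀ a : Fˣ, a = 1 := fun a => by
    ext
    simpa [hF] using FiniteField.pow_card_sub_one_eq_one (a : F) a.ne_zero
  intro x y x' y' hxy hxy' a b
  -- The linear part only has to match the difference vectors; a translation then matches the
  -- points.
  obtain ⟨g, hg⟩ := exists_linearEquiv_apply_eq
    (K := E) (v := fun _ : Unit => y' - x') (w := fun _ : Unit => y - x)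
    (LinearIndependent.of_subsingleton () (sub_ne_zero.2 hxy'.symm))
    (LinearIndependent.of_subsingleton () (sub_ne_zero.2 hxy.symm))
  refine ⟨(g.toEquiv).trans (Equiv.addRight (x - g x')), fun _ => 1, ?_, by simp, ?_,
    (hone a).symm, (hone b).symm⟩
  · rintro c ⟨f, hf, hcf⟩
    refine ⟨aeval (fun i => linearPoly (LinearMap.proj i ∘ₗ g.toLinearMap) + C ((x - g x') i)) f,
      (totalDegree_aeval_le (fun i => ?_) f).trans hf, fun v => ?_⟩
    · exact (totalDegree_add _ _).trans (max_le (totalDegree_linearPoly_le _)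
        (by rw [totalDegree_C]; exact zero_le_one))
    · rw [eval_aeval]
      simp only [monomialMap_apply, Units.val_one, one_mul, hcf]
      congr 1
      congr 1
      ext i
      simp
  · have h := hg ()
    rw [map_sub] at h
    simp only [Equiv.trans_apply, LinearEquiv.coe_toEquiv, Equiv.coe_addRight]
    rw [← sub_add_cancel (g y') (g x'), h]
    abel

theorem isNeighbourTransitive_subfieldRM [Finite E] {ℓ t : ℕ} (hF : Nat.card F = 2)
    (hℓ : (ℓ : ℤ) ≤ ((t : ℤ) - 1) * ((Nat.card E : ℤ) - 1) - 1) :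
    IsNeighbourTransitive 2 (subfieldRM F E ℓ t : Set ((Fin t → E) → F)) := by
  classical
  have : Finite F := Nat.finite_of_card_ne_zero (by omega)
  have := Fintype.ofFinite E
  rw [Nat.card_eq_fintype_card] at hℓ
  have hQ : 1 < Fintype.card E := Fintype.one_lt_card
  -- For `t ≤ 1` the bound would force `ℓ` to be negative.
  have ht : 1 < t := by
    by_contra ht
    have : ((t : ℤ) - 1) * ((Fintype.card E : ℤ) - 1) ≤ 0 :=
      mul_nonpos_of_nonpos_of_nonneg (by omega) (by omega)
    omega
  have : Nonempty (Fin t) := ⟨⟨0, by omega⟩⟩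
  refine isNeighbourTransitive_two_of_monomiallyTwoTransitive _
    (monomiallyTwoTransitive_subfieldRM hF ℓ t) fun c hc h0 =>
      four_le_hammingNorm_of_mem_subfieldRM hF ?_ hc h0
  zify [hQ.le]
  linarith

theorem subfieldRM_self (ℓ t : ℕ) : subfieldRM F F ℓ t = RM F ℓ t := rfl

end Affine

/-! ### Projective codes. -/

section Projective

variable {F E : Type*} [Field F] [Field E] [Algebra F E] {t k ℓ : ℕ} {S : Set (Fin t → E)}

theorem eval_smul_of_mem_polyR {f : MvPolynomial (Fin t) E} (hf : f ∈ polyR F E t k) (a : E)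
    (v : Fin t → E) : eval (a • v) f = algebraMap F E (Algebra.norm F a) ^ k * eval v f := by
  have h := congrArg (eval v) (hf.2 a)
  rw [eval_aeval] at h
  simpa [Pi.smul_def] using h

/-- Linear substitution commutes with scaling the variables. -/
theorem aeval_linearPoly_mem_polyR {f : MvPolynomial (Fin t) E} (hf : f ∈ polyR F E t k)
    (g : (Fin t → E) →ₗ[E] (Fin t → E)) :
    aeval (fun i => linearPoly (LinearMap.proj i ∘ₗ g)) f ∈ polyR F E t k := by
  refine ⟨fun v => by rw [eval_aeval]; exact hf.1 _, fun a => ?_⟩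
  rw [comp_aeval_apply]
  have h : (fun i => aeval (fun j => C a * X j) (linearPoly (LinearMap.proj i ∘ₗ g))) =
      fun i => aeval (fun i => linearPoly (LinearMap.proj i ∘ₗ g))
        (C a * X i : MvPolynomial (Fin t) E) := by
    funext i
    simp only [linearPoly, map_sum, map_mul, aeval_X, ← algebraMap_eq, AlgHom.commutes,
      Finset.mul_sum]
    exact Finset.sum_congr rfl fun j _ => by ring
  rw [h, ← comp_aeval_apply, hf.2 a, map_mul, ← algebraMap_eq, AlgHom.commutes]

theorem eval_zero_of_mem_polyR [Module.Finite F E] (hk : 0 < k) {f : MvPolynomial (Fin t) E}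
    (hf : f ∈ polyR F E t k) : eval 0 f = 0 := by
  have h := eval_smul_of_mem_polyR hf 0 0
  rwa [zero_smul, Algebra.norm_zero, map_zero, zero_pow hk.ne', zero_mul] at h

theorem IsProjectiveReps.ne_zero (hS : IsProjectiveReps S) {v : Fin t → E} (hv : v ∈ S) :
    v ≠ 0 := by
  rintro rfl
  have h : Module.finrank E (Submodule.span E {(0 : Fin t → E)}) = 1 := hS.mapsTo hv
  rw [Submodule.span_zero_singleton, finrank_bot] at h
  exact zero_ne_one h

theorem IsProjectiveReps.exists_eq_smul (hS : IsProjectiveReps S) {x : Fin t → E} (hx : x ≠ 0) :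
    ∃ (v : S) (a : Eˣ), x = (a : E) • (v : Fin t → E) := by
  obtain ⟨v, hv, h⟩ := hS.surjOn (finrank_span_singleton (K := E) hx)
  have hmem : x ∈ Submodule.span E {v} := by
    rw [show Submodule.span E {v} = Submodule.span E {x} from h]
    exact Submodule.mem_span_singleton_self x
  obtain ⟨a, rfl⟩ := Submodule.mem_span_singleton.1 hmem
  exact ⟨⟨v, hv⟩, Units.mk0 a (left_ne_zero_of_smul hx), rfl⟩

theorem IsProjectiveReps.eq_of_smul_eq_smul (hS : IsProjectiveReps S) {v w : S} {a b : Eˣ}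
    (h : (a : E) • (v : Fin t → E) = (b : E) • (w : Fin t → E)) : v = w ∧ a = b := by
  have hvw : v = w := by
    refine Subtype.ext (hS.injOn v.2 w.2 ?_)
    rw [← Submodule.span_singleton_smul_eq a.isUnit, h,
      Submodule.span_singleton_smul_eq b.isUnit]
  subst hvw
  exact ⟨rfl, Units.ext (smul_left_injective E (hS.ne_zero v.2) h)⟩

theorem IsProjectiveReps.linearIndependent (hS : IsProjectiveReps S) {v w : S} (hvw : v ≠ w) :
    LinearIndependent E ![(v : Fin t → E), (w : Fin t → E)] := by
  rw [LinearIndependent.pair_iff' (hS.ne_zero v.2)]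
  intro a h
  have ha : a ≠ 0 := by
    rintro rfl
    exact hS.ne_zero w.2 (by rw [← h, zero_smul])
  exact hvw (hS.eq_of_smul_eq_smul (a := Units.mk0 a ha) (b := 1) (by simpa using h)).1

theorem IsProjectiveReps.nontrivial (hS : IsProjectiveReps S) (ht : 1 < t) : Nontrivial S := by
  let i : Fin t := ⟨0, by omega⟩
  let j : Fin t := ⟨1, ht⟩
  have hij : i ≠ j := by simp [i, j]
  obtain ⟨v, a, hv⟩ := hS.exists_eq_smul (x := Pi.single i 1) (by simp)
  obtain ⟨w, b, hw⟩ := hS.exists_eq_smul (x := Pi.single j 1) (by simp)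
  refine ⟨v, w, fun h => ?_⟩
  subst h
  have h1 := congrFun hv i
  have h2 := congrFun hw i
  simp only [Pi.single_eq_same, Pi.smul_apply, smul_eq_mul, Pi.single_eq_of_ne hij] at h1 h2
  rcases mul_eq_zero.1 h2.symm with h | h
  · exact b.ne_zero h
  · simp [h] at h1

theorem IsProjectiveReps.exists_linearForm (hS : IsProjectiveReps S) {p r : S} (h : r ≠ p) :
    ∃ φ : (Fin t → E) →ₗ[E] E, φ p ≠ 0 ∧ φ r = 0 := by
  have hp : (p : Fin t → E) ∉ Submodule.span E {(r : Fin t → E)} := fun hmem => by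
    obtain ⟨a, ha⟩ := Submodule.mem_span_singleton.1 hmem
    exact (LinearIndependent.pair_iff' (hS.ne_zero r.2)).1 (hS.linearIndependent h) a ha
  obtain ⟨φ, hφ, hle⟩ := Submodule.exists_le_ker_of_notMem hp
  exact ⟨φ, hφ, hle (Submodule.mem_span_singleton_self _)⟩

/-- If `p` and at most two other points support `c`, multiply `f` by linear forms that vanish at the
others but not at `p`, and by factors that kill the multiples `a • p` with `a ≠ 0, 1`. The origin
needs no factor, since `f` vanishes there. The multiplier has degree at most `2 + (Q - 2) = Q`, with
`Q` the order of `E`. -/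
theorem four_le_hammingNorm_of_mem_subfieldPRM [Fintype E] [DecidableEq F] [Fintype S]
    (hS : IsProjectiveReps S) (hk : 0 < k)
    (hℓ : ℓ + Fintype.card E < (Fintype.card E - 1) * t) {c : S → F}
    (hc : c ∈ subfieldPRM F E k ℓ t S) (h0 : c ≠ 0) : 4 ≤ hammingNorm c := by
  classical
  by_contra hlt
  obtain ⟨f, hfR, hf, hcf⟩ := hc
  obtain ⟨p, hp⟩ := Function.ne_iff.1 h0
  rw [Pi.zero_apply] at hp
  let T : Finset S := (Finset.univ.filter fun r => c r ≠ 0).erase p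
  have hT : T.card ≤ 2 := by
    rw [Finset.card_erase_of_mem (by simpa using hp)]
    rw [hammingNorm] at hlt
    omega
  obtain ⟨ψ, hψ⟩ : ∃ ψ : (Fin t → E) →ₗ[E] E, ψ p = 1 := by
    obtain ⟨ψ, hψ, -⟩ := Submodule.exists_le_ker_of_notMem (p := (⊥ : Submodule E (Fin t → E)))
      (by simpa using hS.ne_zero p.2)
    exact ⟨(ψ p)⁻¹ • ψ, by simp [hψ]⟩
  have hφ : ∀ r : S, ∃ φ : (Fin t → E) →ₗ[E] E, r ≠ p → φ p ≠ 0 ∧ φ r = 0 := fun r => by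
    by_cases h : r = p
    · exact ⟨0, fun h' => absurd h h'⟩
    · obtain ⟨φ, hφ⟩ := hS.exists_linearForm h
      exact ⟨φ, fun _ => hφ⟩
  choose φ hφ using hφ
  let A : Finset E := (Finset.univ.erase 0).erase 1
  have hA : A.card + 2 = Fintype.card E := by
    have hQ : 1 < Fintype.card E := Fintype.one_lt_card
    rw [Finset.card_erase_of_mem (by simp), Finset.card_erase_of_mem (by simp), Finset.card_univ]
    omega
  let g : MvPolynomial (Fin t) E := (∏ a ∈ A, (linearPoly ψ - C a)) * ∏ r ∈ T, linearPoly (φ r)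
  have hg : g.totalDegree ≤ Fintype.card E := by
    have h1 : (∏ a ∈ A, (linearPoly ψ - C a)).totalDegree ≤ A.card :=
      (totalDegree_finsetProd _ _).trans <| (Finset.sum_le_card_nsmul _ _ 1 fun a _ =>
        (totalDegree_sub_C_le _ _).trans (totalDegree_linearPoly_le _)).trans (by simp)
    have h2 : (∏ r ∈ T, linearPoly (φ r)).totalDegree ≤ T.card :=
      (totalDegree_finsetProd _ _).trans <| (Finset.sum_le_card_nsmul _ _ 1 fun r _ =>
        totalDegree_linearPoly_le _).trans (by simp)
    have h3 := totalDegree_mul (∏ a ∈ A, (linearPoly ψ - C a)) (∏ r ∈ T, linearPoly (φ r))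
    change (_ * _ : MvPolynomial (Fin t) E).totalDegree ≤ _
    omega
  have hgx : ∀ x, eval x g = (∏ a ∈ A, (ψ x - a)) * ∏ r ∈ T, φ r x := fun x => by
    simp [g]
  have h := eval_mul_eval_eq_zero (f := f) (g := g) (p := p) (by omega) fun x hx => by
    by_cases hx0 : x = 0
    · rw [hx0, eval_zero_of_mem_polyR hk hfR, zero_mul]
    obtain ⟨v, a, rfl⟩ := hS.exists_eq_smul hx0
    rw [eval_smul_of_mem_polyR hfR, ← hcf, hgx]
    by_cases hv : v = p
    · subst hv
      have ha : (a : E) ∈ A := by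
        refine Finset.mem_erase.2 ⟨fun h1 => hx (by rw [h1, one_smul]), ?_⟩
        simp
      rw [Finset.prod_eq_zero ha (by simp [hψ]), zero_mul, mul_zero]
    · by_cases hcv : c v = 0
      · simp [hcv]
      · have hvT : v ∈ T := by simp [T, hv, hcv]
        rw [Finset.prod_eq_zero hvT (by simp [(hφ v hv).2]), mul_zero, mul_zero]
  rw [← hcf, hgx, hψ] at h
  simp only [mul_eq_zero, Finset.prod_eq_zero_iff, map_eq_zero, hp, false_or] at h
  rcases h with ⟨a, ha, h⟩ | ⟨r, hr, h⟩
  · exact (Finset.mem_erase.1 ha).1 (sub_eq_zero.1 h).symm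
  · exact (hφ r (Finset.mem_erase.1 hr).1).1 h

/-- The norm is onto, and `k`-th powering permutes a group whose order is coprime to `k`. -/
theorem exists_norm_pow_eq [Finite E] (hk : Nat.gcd k (Nat.card F - 1) = 1) (a : Fˣ) :
    ∃ b : Eˣ, Units.map (Algebra.norm F (S := E)) b ^ k = a := by
  have : Finite F := Finite.of_injective _ (algebraMap F E).injective
  have hcop : (Nat.card Fˣ).Coprime k := by
    rw [Nat.card_units, Nat.coprime_comm]
    exact hk
  obtain ⟨c, rfl⟩ := (powCoprime hcop).surjective a
  obtain ⟨b, rfl⟩ := FiniteField.unitsMap_norm_surjective F E c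
  exact ⟨b, rfl⟩

/-- Distinct representatives are independent, so some `g` sends `i', j'` to any chosen multiples of
`i, j`. On representatives `g` is a permutation `σ` with factors `μ`, and homogeneity turns `μ` into
the scalars `N(μ)^k`. -/
theorem monomiallyTwoTransitive_subfieldPRM [Finite E] (hS : IsProjectiveReps S)
    (hk : Nat.gcd k (Nat.card F - 1) = 1) :
    MonomiallyTwoTransitive (subfieldPRM F E k ℓ t S : Set (S → F)) := by
  intro i j i' j' hij hij' a b
  obtain ⟨α, hα⟩ := exists_norm_pow_eq (E := E) hk a
  obtain ⟨β, hβ⟩ := exists_norm_pow_eq (E := E) hk b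
  obtain ⟨g, hg⟩ := exists_linearEquiv_apply_eq (hS.linearIndependent hij')
    ((hS.linearIndependent hij).units_smul ![α, β])
  have hgi : g i' = (α : E) • (i : Fin t → E) := by simpa [Units.smul_def] using hg 0
  have hgj : g j' = (β : E) • (j : Fin t → E) := by simpa [Units.smul_def] using hg 1
  have hrep : ∀ v : S, ∃ (w : S) (m : Eˣ), g v = (m : E) • (w : Fin t → E) := fun v =>
    hS.exists_eq_smul (by simpa using hS.ne_zero v.2)
  choose σ μ hσμ using hrep
  have hinj : Function.Injective σ := fun v w hvw => by
    have h : ((μ v)⁻¹ : Eˣ) • (v : Fin t → E) = ((μ w)⁻¹ : Eˣ) • (w : Fin t → E) := by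
      apply g.injective
      simp only [Units.smul_def, map_smul, hσμ, hvw, smul_smul, Units.inv_mul]
    exact (hS.eq_of_smul_eq_smul h).1
  have hi := hS.eq_of_smul_eq_smul ((hσμ i').symm.trans hgi)
  have hj := hS.eq_of_smul_eq_smul ((hσμ j').symm.trans hgj)
  refine ⟨Equiv.ofBijective σ (Finite.injective_iff_bijective.1 hinj),
    fun v => Units.map (Algebra.norm F (S := E)) (μ v) ^ k, ?_, hi.1, hj.1,
    by simp only [hi.2, hα], by simp only [hj.2, hβ]⟩
  rintro c ⟨f, hfR, hf, hcf⟩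
  refine ⟨_, aeval_linearPoly_mem_polyR hfR g.toLinearMap,
    (totalDegree_aeval_le (fun i => totalDegree_linearPoly_le _) f).trans hf, fun v => ?_⟩
  have hgv : (fun i => eval (v : Fin t → E) (linearPoly (LinearMap.proj i ∘ₗ g.toLinearMap))) =
      (μ v : E) • (σ v : Fin t → E) := by
    rw [← hσμ]
    ext i
    simp
  rw [eval_aeval, hgv, eval_smul_of_mem_polyR hfR, ← hcf]
  simp

theorem isNeighbourTransitive_subfieldPRM [Finite E] (hS : IsProjectiveReps S) (hk : 0 < k)
    (hgcd : Nat.gcd k (Nat.card F - 1) = 1)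
    (hℓ : (ℓ : ℤ) ≤ ((t : ℤ) - 1) * ((Nat.card E : ℤ) - 1) - 2) :
    IsNeighbourTransitive 2 (subfieldPRM F E k ℓ t S : Set (S → F)) := by
  classical
  have : Finite F := Finite.of_injective _ (algebraMap F E).injective
  have := Fintype.ofFinite E
  have := Fintype.ofFinite S
  rw [Nat.card_eq_fintype_card] at hℓ
  have hQ : 1 < Fintype.card E := Fintype.one_lt_card
  have ht : 1 < t := by
    by_contra ht
    have : ((t : ℤ) - 1) * ((Fintype.card E : ℤ) - 1) ≤ 0 :=
      mul_nonpos_of_nonpos_of_nonneg (by omega) (by omega)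
    omega
  have := hS.nontrivial ht
  refine isNeighbourTransitive_two_of_monomiallyTwoTransitive _
    (monomiallyTwoTransitive_subfieldPRM hS hgcd) fun c hc h0 =>
      four_le_hammingNorm_of_mem_subfieldPRM hS hk ?_ hc h0
  zify [hQ.le]
  linarith

end Projective

end NTCodes

theorem proposition5p2 (F E : Type*) [Field F] [Finite F] [Field E] [Finite E] [Algebra F E]
    (q s t k ℓ : ℕ) (hs : 0 < s) (hF : Nat.card F = q) (hE : Nat.card E = q ^ s)
    (hk : 0 < k) (hkq : k ≤ q - 1) :
    (q = 2 → (ℓ : ℤ) ≤ (t : ℤ) - 2 →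
      NTCodes.IsNeighbourTransitive 2 (NTCodes.RM F ℓ t : Set ((Fin t → F) → F))) ∧
    (q = 2 → (ℓ : ℤ) ≤ ((t : ℤ) - 1) * (2 ^ s - 1) - 1 →
      NTCodes.IsNeighbourTransitive 2 (NTCodes.subfieldRM F E ℓ t : Set ((Fin t → E) → F))) ∧
    ((ℓ : ℤ) ≤ ((t : ℤ) - 1) * ((q : ℤ) - 1) - 2 → Nat.gcd k (q - 1) = 1 →
      ∀ S : Set (Fin t → F), NTCodes.IsProjectiveReps S →
        NTCodes.IsNeighbourTransitive 2 (NTCodes.PRM F k ℓ t S : Set (S → F))) ∧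
    ((ℓ : ℤ) ≤ ((t : ℤ) - 1) * ((q : ℤ) ^ s - 1) - 2 → Nat.gcd k (q - 1) = 1 →
      ∀ S : Set (Fin t → E), NTCodes.IsProjectiveReps S →
        NTCodes.IsNeighbourTransitive 2 (NTCodes.subfieldPRM F E k ℓ t S : Set (S → F))) := by
  subst hF
  refine ⟨fun hq hℓ => ?_, fun hq hℓ => ?_, fun hℓ hgcd S hS => ?_, fun hℓ hgcd S hS => ?_⟩
  -- With `E = F` of order 2, the bound `(t - 1)(2 - 1) - 1` is `t - 2`.
  · rw [← NTCodes.subfieldRM_self]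
    refine NTCodes.isNeighbourTransitive_subfieldRM hq ?_
    rw [hq]
    push_cast
    linarith
  · refine NTCodes.isNeighbourTransitive_subfieldRM hq ?_
    rw [hE, hq]
    exact_mod_cast hℓ
  · exact NTCodes.isNeighbourTransitive_subfieldPRM hS hk hgcd hℓ
  · refine NTCodes.isNeighbourTransitive_subfieldPRM hS hk hgcd ?_
    rw [hE]
    exact_mod_cast hℓ
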